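/- Let $X$ be a connected topological manifold (Hausdorff, second countable, without boundary) with finitely generated fundamental group, and let $\pi\colon E\to X$ be a flat Euclidean circle bundle, that is, a fibre bundle with fibre the unit circle $S^1\subset\mathbb{R}^2$ and an atlas of local trivializations all of whose transition functions are locally constant with values in $O(2)$. Then there is a finite Galois (i.e. regular) covering $p\colon\bar X\to X$ with $\bar X$ connected such that (1) the pullback bundle $p^*E\to\bar X$ is trivial as an $O(2)$-circle bundle: there is a global trivialization $p^*E\cong\bar X\times S^1$ over $\bar X$ which on each fibre differs from the pulled-back local trivializations by elements of $O(2)$; (2) consequently, the fundamental group $\pi_1(E)$ of the total space (at any base point) has a finite-index normal subgroup isomorphic to $\mathbb{Z}\times\pi_1(\bar X)$. -/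

import Mathlib

open Bundle Topology

/-- The orthogonal group `O(2)`: the linear isometries of the Euclidean plane `ℂ = ℝ²`. It acts on
the unit circle `Circle ⊆ ℂ` by restriction. -/
abbrev O2 : Type := ℂ ≃ₗᵢ[ℝ] ℂ

section Bundles

variable {B : Type*} [TopologicalSpace B] {E : B → Type*} [TopologicalSpace (TotalSpace Circle E)]

/-- Two local trivializations of a circle bundle define the same `O(2)`-structure where both are
defined: the coordinate change over each point of the common domain is (the restriction to the unit
circle of) an element of `O(2)`. It varies continuously with the point, because the coordinate
change is jointly continuous in the point and the fibre coordinate. -/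
def O2Compatible (e e' : Trivialization Circle (π Circle E)) : Prop :=
  ∀ x ∈ e.baseSet ∩ e'.baseSet, ∃ g : O2, ∀ z : Circle, (e.coordChange e' x z : ℂ) = g z

/-- Two local trivializations are flatly compatible: the coordinate change is a locally constant
function, with values in `O(2)`, on the common domain. -/
def FlatO2Compatible (e e' : Trivialization Circle (π Circle E)) : Prop :=
  ∀ x ∈ e.baseSet ∩ e'.baseSet, ∃ g : O2, ∀ᶠ y in 𝓝 x, ∀ z : Circle,
    (e.coordChange e' y z : ℂ) = g z

variable (E) [∀ b, TopologicalSpace (E b)] [FiberBundle Circle E]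

/-- A circle bundle, with its atlas of local trivializations, is an `O(2)`-circle bundle. -/
def IsO2CircleBundle : Prop :=
  ∀ e ∈ trivializationAtlas Circle E, ∀ e' ∈ trivializationAtlas Circle E, O2Compatible e e'

/-- A circle bundle, with its atlas of local trivializations, is a flat Euclidean circle bundle:
the structure group is `O(2)` with the discrete topology, i.e. all transition functions of the
atlas are locally constant with values in `O(2)`. -/
def IsFlatO2CircleBundle : Prop :=
  ∀ e ∈ trivializationAtlas Circle E, ∀ e' ∈ trivializationAtlas Circle E, FlatO2Compatible e e'

/-- A circle bundle is an `O(2)`-circle bundle that is trivial as such: there is a global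
trivialization, i.e. a homeomorphism of the total space with `B × Circle` over `B`, which is
`O(2)`-compatible with the local trivializations of the atlas. -/
def IsTrivialO2CircleBundle : Prop :=
  IsO2CircleBundle E ∧
    ∃ t : Trivialization Circle (π Circle E), t.baseSet = Set.univ ∧
      ∀ e ∈ trivializationAtlas Circle E, O2Compatible e t

end Bundles

/-- `p : Y → X` is a finite Galois (regular) covering with connected total space: a surjective
covering map with finite fibres whose deck transformations act transitively on each fibre. -/
structure IsFiniteGaloisCover {X Y : Type*} [TopologicalSpace X] [TopologicalSpace Y]
    (p : Y → X) : Prop where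
  connected : ConnectedSpace Y
  isCoveringMap : IsCoveringMap p
  surjective : Function.Surjective p
  finite_fiber : ∀ x, (p ⁻¹' {x}).Finite
  transitive : ∀ y y' : Y, p y = p y' → ∃ h : Y ≃ₜ Y, (∀ w, p (h w) = p w) ∧ h y = y'

/-! Locally constant transition functions are cocycles for the discrete group `O(2)`, so the
principal bundle `P` is a covering of `X`. Its holonomy group `Γ` is a quotient of `π₁(X)`, hence
finitely generated. The rotations in `Γ` form a finitely generated abelian group of index at most 2,
and their `m`-th powers, for `m` killing the torsion, form a free abelian group `N` of finite index,
normal in `Γ`. Freeness lets angles be chosen additively: `n = exp(i l(n))` with `l : N → ℝ` a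
homomorphism (`exists_additive_angle`).

The covering `X̄` is a component of `P / N`, with `Γ` acting by deck transformations. Over it the
holonomy lies in `N`. Since `ℝ` is convex, a partition of unity gives a continuous `f : P → ℝ` with
`f(bn) = f(b) + l(n)` (`FlatCocycle.exists_continuous_equivariant`). Rotating by `exp(i f)` cancels
the holonomy; the resulting trivialization respects `O(2)` but need not be flat.

For the fundamental group, `p*E ≅ X̄ × S¹` is a finite regular covering of `E`, and `π₁` of a finite
regular covering embeds as a normal subgroup of finite index. -/

theorem IsCoveringMap.exists_monodromy_eq {E X : Type*} [TopologicalSpace E] [TopologicalSpace X]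
    {p : E → X} (cov : IsCoveringMap p) {x y : X} (e : p ⁻¹' {x}) (e' : p ⁻¹' {y})
    (a : Path (e : E) e') : ∃ l : Path.Homotopic.Quotient x y, cov.monodromy l e = e' := by
  obtain ⟨e, rfl⟩ := e
  obtain ⟨e', rfl⟩ := e'
  exact ⟨_, cov.monodromy_map (.mk a)⟩

/-- A cocycle of locally constant transition functions on a space `B` with values in a group `G`. -/
structure FlatCocycle (ι B G : Type*) [TopologicalSpace B] [Group G] where
  baseSet : ι → Set B
  isOpen_baseSet : ∀ i, IsOpen (baseSet i)
  indexAt : B → ι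
  mem_baseSet_at : ∀ x, x ∈ baseSet (indexAt x)
  trans : ι → ι → B → G
  trans_self : ∀ i, ∀ x ∈ baseSet i, trans i i x = 1
  trans_mul_trans : ∀ i j k, ∀ x ∈ baseSet i ∩ baseSet j ∩ baseSet k,
    trans j k x * trans i j x = trans i k x
  eventually_trans_eq : ∀ i j, ∀ x ∈ baseSet i ∩ baseSet j,
    ∀ᶠ y in 𝓝 x, trans i j y = trans i j x

namespace FlatCocycle

variable {ι B G : Type*} [TopologicalSpace B] [Group G] (Z : FlatCocycle ι B G)

/-! ### Coverings associated with a flat cocycle -/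

section Assoc

variable (F : Type*) [TopologicalSpace F] [DiscreteTopology F] [MulAction G F]

/-- The bundle with discrete fibre `F` associated with a flat cocycle. -/
@[simps]
def assoc : FiberBundleCore ι B F where
  baseSet := Z.baseSet
  isOpen_baseSet := Z.isOpen_baseSet
  indexAt := Z.indexAt
  mem_baseSet_at := Z.mem_baseSet_at
  coordChange i j x v := Z.trans i j x • v
  coordChange_self i x hx v := by rw [Z.trans_self i x hx, one_smul]
  continuousOn_coordChange i j := by
    rintro ⟨x, v⟩ ⟨hx, -⟩
    refine ContinuousAt.continuousWithinAt ?_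
    have h1 : ∀ᶠ p : B × F in 𝓝 (x, v), Z.trans i j p.1 • p.2 = Z.trans i j x • v := by
      have h2 : ∀ᶠ w in 𝓝 v, w = v := by simp [nhds_discrete]
      rw [nhds_prod_eq]
      filter_upwards [(Z.eventually_trans_eq i j x hx).prod_mk h2] with p hp
      rw [hp.1, hp.2]
    exact continuousAt_const.congr (h1.mono fun _ h => h.symm)
  coordChange_comp i j k x hx v := by rw [smul_smul, Z.trans_mul_trans i j k x hx]

/-- The total space of the associated bundle. -/
abbrev AssocSpace := TotalSpace F (Z.assoc F).Fiber

theorem isCoveringMap_proj : IsCoveringMap (π F (Z.assoc F).Fiber) :=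
  FiberBundle.isCoveringMap

variable {F}

/-- The point with coordinate `v` over `x` in the preferred chart at `x`. -/
def mkAt (x : B) (v : F) : Z.AssocSpace F := ⟨x, v⟩

/-- The coordinate of a point in the preferred chart. -/
def val (p : Z.AssocSpace F) : F := p.2

@[simp] theorem mkAt_proj (x : B) (v : F) : (Z.mkAt x v).1 = x := rfl

@[simp] theorem val_mkAt (x : B) (v : F) : Z.val (Z.mkAt x v) = v := rfl

@[simp] theorem mkAt_val (p : Z.AssocSpace F) : Z.mkAt p.1 (Z.val p) = p := rfl

/-- The point with coordinate `v` over `x` in the chart `i`. -/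
def point (i : ι) (x : B) (v : F) : Z.AssocSpace F :=
  Z.mkAt x (Z.trans i (Z.indexAt x) x • v)

/-- The coordinate of a point of the associated bundle in the chart `i`. -/
def coord (i : ι) (p : Z.AssocSpace F) : F :=
  Z.trans (Z.indexAt p.1) i p.1 • Z.val p

@[simp] theorem point_proj (i : ι) (x : B) (v : F) : (Z.point i x v).1 = x := rfl

theorem coord_point {i j : ι} {x : B} (hi : x ∈ Z.baseSet i) (hj : x ∈ Z.baseSet j) (v : F) :
    Z.coord j (Z.point i x v) = Z.trans i j x • v := by
  simp only [coord, point, smul_smul, val_mkAt, mkAt_proj]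
  rw [Z.trans_mul_trans _ _ _ _ ⟨⟨hi, Z.mem_baseSet_at x⟩, hj⟩]

theorem point_coord {i : ι} (p : Z.AssocSpace F) (hi : p.1 ∈ Z.baseSet i) :
    Z.point i p.1 (Z.coord i p) = p := by
  simp only [coord, point, smul_smul]
  rw [Z.trans_mul_trans _ _ _ _ ⟨⟨Z.mem_baseSet_at _, hi⟩, Z.mem_baseSet_at _⟩,
    Z.trans_self _ _ (Z.mem_baseSet_at _), one_smul, mkAt_val]

theorem coord_eq_trans_smul {i j : ι} (p : Z.AssocSpace F) (hi : p.1 ∈ Z.baseSet i)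
    (hj : p.1 ∈ Z.baseSet j) : Z.coord j p = Z.trans i j p.1 • Z.coord i p := by
  conv_lhs => rw [← Z.point_coord p hi]
  exact Z.coord_point hi hj _

theorem continuousOn_point (i : ι) (v : F) :
    ContinuousOn (fun x => Z.point i x v) (Z.baseSet i) := by
  have h := ((Z.assoc F).localTriv i).continuousOn_invFun
  exact h.comp (f := fun x : B => (x, v)) (by fun_prop)
    (fun x hx => ((Z.assoc F).localTriv i).mem_target.2 hx)

theorem continuousOn_coord (i : ι) :
    ContinuousOn (Z.coord (F := F) i) {p | p.1 ∈ Z.baseSet i} := by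
  have h := ((Z.assoc F).localTriv i).continuousOn_toFun
  exact (continuous_snd.comp_continuousOn h :)

theorem eventually_coord_eq (i : ι) (p : Z.AssocSpace F) (hi : p.1 ∈ Z.baseSet i) :
    ∀ᶠ q in 𝓝 p, q.1 ∈ Z.baseSet i ∧ Z.coord i q = Z.coord i p := by
  have ho : {p : Z.AssocSpace F | p.1 ∈ Z.baseSet i} ∈ 𝓝 p :=
    ((Z.isOpen_baseSet i).preimage (Z.assoc F).continuous_proj).mem_nhds hi
  have h := (Z.continuousOn_coord (F := F) i).continuousAt ho
  have h2 : ∀ᶠ w in 𝓝 (Z.coord i p), w = Z.coord i p := by simp [nhds_discrete]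
  filter_upwards [ho, h.eventually h2] with q h3 h4 using ⟨h3, h4⟩

theorem eventually_eq_point (i : ι) (p : Z.AssocSpace F) (hi : p.1 ∈ Z.baseSet i) :
    ∀ᶠ q in 𝓝 p, q.1 ∈ Z.baseSet i ∧ q = Z.point i q.1 (Z.coord i p) := by
  filter_upwards [Z.eventually_coord_eq i p hi] with q hq
  exact ⟨hq.1, by rw [← hq.2, Z.point_coord q hq.1]⟩

end Assoc

section Functoriality

variable {F F' : Type*} [TopologicalSpace F] [DiscreteTopology F] [MulAction G F]
  [TopologicalSpace F'] [DiscreteTopology F'] [MulAction G F']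

/-- The map of associated bundles induced by an equivariant map of fibres. -/
def assocMap (f : F →[G] F') (p : Z.AssocSpace F) : Z.AssocSpace F' :=
  Z.mkAt p.1 (f (Z.val p))

theorem assocMap_point (f : F →[G] F') (i : ι) (x : B) (v : F) :
    Z.assocMap f (Z.point i x v) = Z.point i x (f v) := by
  simp only [assocMap, point, map_smul, val_mkAt, mkAt_proj]

theorem coord_assocMap (f : F →[G] F') (i : ι) (p : Z.AssocSpace F) :
    Z.coord i (Z.assocMap f p) = f (Z.coord i p) := by
  simp only [assocMap, coord, map_smul, val_mkAt, mkAt_proj]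

/-- In a chart the map fixes the base point and applies `f` to a locally constant coordinate, so it
carries local constant sections to local constant sections. -/
theorem continuous_assocMap (f : F →[G] F') : Continuous (Z.assocMap f) := by
  refine continuous_iff_continuousAt.2 fun p => ?_
  set i := Z.indexAt p.1
  have hi : p.1 ∈ Z.baseSet i := Z.mem_baseSet_at _
  have h := (Z.continuousOn_point i (f (Z.coord i p))).continuousAt
    ((Z.isOpen_baseSet i).mem_nhds hi)
  have h2 : ContinuousAt (fun q : Z.AssocSpace F => Z.point i q.1 (f (Z.coord i p))) p :=
    ContinuousAt.comp (f := fun q : Z.AssocSpace F => q.1) h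
      (Z.assoc F).continuous_proj.continuousAt
  refine h2.congr ?_
  filter_upwards [Z.eventually_eq_point i p hi] with q hq
  conv_rhs => rw [hq.2, assocMap_point]

end Functoriality

/-! ### The principal bundle and its holonomy -/

section Principal

variable [TopologicalSpace G] [DiscreteTopology G]

/-- Right multiplication as an equivariant map. -/
@[simps]
def mulRightHom (γ : G) : G →[G] G where
  toFun g := g * γ
  map_smul' a g := by simp [mul_assoc]

instance : MulAction Gᵐᵒᵖ (Z.AssocSpace G) where
  smul γ p := Z.assocMap (mulRightHom γ.unop) p
  one_smul p := by
    change Z.mkAt p.1 (Z.val p * 1) = p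
    rw [mul_one, mkAt_val]
  mul_smul a b p := by
    change Z.mkAt p.1 (Z.val p * _) = Z.mkAt p.1 (Z.val p * _ * _)
    rw [MulOpposite.unop_mul, mul_assoc]

theorem op_smul_def (γ : G) (p : Z.AssocSpace G) :
    MulOpposite.op γ • p = Z.assocMap (mulRightHom γ) p := rfl

/-- Two points of a fibre of the principal bundle differ by a unique group element. -/
theorem exists_op_smul_eq {p q : Z.AssocSpace G} (h : p.1 = q.1) :
    ∃ γ : G, MulOpposite.op γ • p = q := by
  refine ⟨(Z.val p)⁻¹ * Z.val q, ?_⟩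
  change Z.mkAt p.1 (Z.val p * ((Z.val p)⁻¹ * Z.val q)) = q
  rw [mul_inv_cancel_left, h, mkAt_val]

/-- Right translations commute with the transition functions, which act on the left, and are simply
transitive on each fibre. -/
theorem isQuotientCoveringMap_proj :
    IsQuotientCoveringMap (π G (Z.assoc G).Fiber) Gᵐᵒᵖ := by
  refine (isQuotientCoveringMap_iff_isCoveringMap_and _ _).2 ⟨Z.isCoveringMap_proj G,
    fun x => ⟨Z.mkAt x 1, rfl⟩, ⟨fun γ => Z.continuous_assocMap _⟩, ⟨?_⟩, ?_⟩
  · intro a b p h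
    have h1 : Z.val p * a.unop = Z.val p * b.unop := TotalSpace.mk_inj.1 h
    exact MulOpposite.unop_injective (mul_left_cancel h1)
  · intro p q
    constructor
    · intro h
      obtain ⟨γ, hγ⟩ := Z.exists_op_smul_eq h.symm
      exact ⟨_, hγ⟩
    · rintro ⟨γ, rfl⟩
      rfl

/-- The monodromy group of a flat cocycle at a point of the principal bundle. -/
noncomputable def monodromyGroup {x : B} (e : π G (Z.assoc G).Fiber ⁻¹' {x}) : Subgroup G :=
  ((MulEquiv.opOp G).symm.toMonoidHom.comp
    (Z.isQuotientCoveringMap_proj.fundamentalGroupToMulOpposite e)).range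

theorem fg_monodromyGroup {x : B} (e : π G (Z.assoc G).Fiber ⁻¹' {x})
    (h : Group.FG (FundamentalGroup B x)) : Group.FG (Z.monodromyGroup e) :=
  Group.fg_range _

/-- A path from `e` to its translate by `γ` is the lift of a loop at `x` whose monodromy moves `e`
by `γ`. -/
theorem mem_monodromyGroup_iff {x : B} (e : π G (Z.assoc G).Fiber ⁻¹' {x}) (γ : G) :
    γ ∈ Z.monodromyGroup e ↔
      Joined (e : Z.AssocSpace G) (MulOpposite.op γ • (e : Z.AssocSpace G)) := by
  have key : γ ∈ Z.monodromyGroup e ↔ ∃ l : FundamentalGroup B x,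
      MulOpposite.op γ • (e : Z.AssocSpace G) =
        (Z.isQuotientCoveringMap_proj.isCoveringMap.monodromy l e : Z.AssocSpace G) := by
    refine exists_congr fun l => ?_
    -- Two opposites occur: the acting group is `Gᵐᵒᵖ`, and the monodromy homomorphism lands in its
    -- opposite.
    rw [show (MulOpposite.op γ) = (MulOpposite.op (MulOpposite.op γ)).unop from rfl,
      ← Z.isQuotientCoveringMap_proj.fundamentalGroupToMulOpposite_apply_eq_Iff]
    change MulOpposite.unop (MulOpposite.unop _) = γ ↔ _
    rw [← MulOpposite.unop_inj, ← MulOpposite.unop_inj]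
    rfl
  rw [key]
  constructor
  · rintro ⟨l, hl⟩
    rw [hl]
    obtain ⟨a⟩ := Z.isQuotientCoveringMap_proj.isCoveringMap.liftPathQuotient l e
    exact ⟨a⟩
  · rintro ⟨a⟩
    obtain ⟨l, hl⟩ := Z.isQuotientCoveringMap_proj.isCoveringMap.exists_monodromy_eq e
      ⟨MulOpposite.op γ • (e : Z.AssocSpace G), (e.2 : (e : Z.AssocSpace G).1 = x)⟩ a
    exact ⟨l, by rw [hl]⟩

end Principal

end FlatCocycle

/-! ### General facts on covering maps -/

/-- The restriction of a covering map to a clopen set is a covering map, if the base is locally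
connected. -/
theorem IsCoveringMap.restrict_isClopen {E X : Type*} [TopologicalSpace E] [TopologicalSpace X]
    [LocallyConnectedSpace X] {p : E → X} (cov : IsCoveringMap p) {S : Set E} (hS : IsClopen S) :
    IsCoveringMap (fun e : S => p e) := by
  intro x
  obtain ⟨disc, U, hxU, hU, hfU, H, hH⟩ := cov x
  set V := connectedComponentIn U x with hV
  have hVU : V ⊆ U := connectedComponentIn_subset U x
  have hVo : IsOpen V := hU.connectedComponentIn
  have hxV : x ∈ V := mem_connectedComponentIn hxU
  have hVc : IsPreconnected V := isPreconnected_connectedComponentIn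
  have : PreconnectedSpace V := Subtype.preconnectedSpace hVc
  let s : V → p ⁻¹' {x} → E := fun v i => (H.symm (⟨v, hVU v.2⟩, i)).1
  have hs : Continuous (Function.uncurry s) := by
    refine continuous_subtype_val.comp (H.symm.continuous.comp ?_)
    fun_prop
  have hps : ∀ v i, p (s v i) = v := fun v i => by
    simp only [s]
    rw [← hH, H.apply_symm_apply]
  -- Each sheet over the connected set `V` lies entirely inside or entirely outside the clopen set
  -- `S`.
  have hconst : ∀ i v w, s v i ∈ S → s w i ∈ S := by
    intro i v w hv
    have hc : IsClopen ((fun v => s v i) ⁻¹' S) :=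
      hS.preimage (hs.comp (by fun_prop : Continuous fun v : V => (v, i)))
    rcases isClopen_iff.1 hc with h | h
    · exact absurd (show v ∈ (fun v => s v i) ⁻¹' S from hv) (by simp [h])
    · exact (by simp [h] : w ∈ (fun v => s v i) ⁻¹' S)
  have hsH : ∀ (e : E) (he : p e ∈ V), s ⟨p e, he⟩ (H ⟨e, hVU he⟩).2 = e := by
    intro e he
    have : (⟨⟨p e, hVU he⟩, (H ⟨e, hVU he⟩).2⟩ : U × p ⁻¹' {x}) = H ⟨e, hVU he⟩ :=
      Prod.ext (Subtype.ext (hH ⟨e, hVU he⟩).symm) rfl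
    simp only [s]
    rw [this, H.symm_apply_apply]
  have hHs : ∀ v i (h : p (s v i) ∈ U), (H ⟨s v i, h⟩).2 = i := by
    intro v i h
    have : (⟨s v i, h⟩ : p ⁻¹' U) = H.symm (⟨v, hVU v.2⟩, i) := Subtype.ext rfl
    rw [this, H.apply_symm_apply]
  refine IsEvenlyCovered.to_isEvenlyCovered_preimage (I := {i : p ⁻¹' {x} // s ⟨x, hxV⟩ i ∈ S})
    ⟨inferInstance, V, hxV, hVo,
      hVo.preimage (cov.continuous.comp continuous_subtype_val), ?_, ?_⟩
  · exact
      { toFun := fun e => (⟨p e.1.1, e.2⟩, ⟨(H ⟨e.1.1, hVU e.2⟩).2,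
          hconst _ ⟨p e.1.1, e.2⟩ _ (by rw [hsH]; exact e.1.2)⟩)
        invFun := fun vk => ⟨⟨s vk.1 vk.2.1, hconst _ _ _ vk.2.2⟩, by
          change p (s vk.1 vk.2.1) ∈ V
          rw [hps]; exact vk.1.2⟩
        left_inv := fun e => Subtype.ext (Subtype.ext (hsH e.1.1 e.2))
        right_inv := fun vk => Prod.ext (Subtype.ext (hps _ _)) (Subtype.ext (hHs _ _ _))
        continuous_toFun := by
          have hp := cov.continuous
          have h1 : Continuous fun e : (fun e : S => p e) ⁻¹' V =>
              H ⟨e.1.1, hVU e.2⟩ := H.continuous.comp (by fun_prop)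
          fun_prop
        continuous_invFun := by
          have h1 : Continuous fun vk : V × {i : p ⁻¹' {x} // s ⟨x, hxV⟩ i ∈ S} => s vk.1 vk.2.1 :=
            hs.comp (by fun_prop : Continuous fun vk :
              V × {i : p ⁻¹' {x} // s ⟨x, hxV⟩ i ∈ S} => (vk.1, vk.2.1))
          fun_prop }
  · intro e
    rfl

theorem IsLocalHomeomorph.locallyPathConnectedSpace {E X : Type*} [TopologicalSpace E]
    [TopologicalSpace X] [LocallyPathConnectedSpace X] {p : E → X} (hp : IsLocalHomeomorph p) :
    LocallyPathConnectedSpace E :=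
  letI : ChartedSpace X E :=
    { atlas := Set.univ
      chartAt := fun e => (hp e).choose
      mem_chart_source := fun e => (hp e).choose_spec.1
      chart_mem_atlas := fun _ => trivial }
  ChartedSpace.locallyPathConnectedSpace X E

/-- Project the path to `X` and lift it to `E` from `e`. The image of the lift under `f` and the
given path lift the same path from the same point, so they agree. -/
theorem IsCoveringMap.joined_of_comp_eq {E E' X : Type*} [TopologicalSpace E] [TopologicalSpace E']
    [TopologicalSpace X] {p : E → X} {p' : E' → X} (cov : IsCoveringMap p)
    (cov' : IsCoveringMap p') {f : E → E'} (hf : Continuous f) (hpf : ∀ e, p' (f e) = p e)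
    {e : E} {e' : E'} (h : Joined (f e) e') : ∃ e₁ : E, f e₁ = e' ∧ Joined e e₁ := by
  obtain ⟨a⟩ := h
  obtain ⟨b, hb, hb0⟩ := cov.exists_path_lifts
    ((⟨p', cov'.continuous⟩ : C(E', X)).comp a.toContinuousMap) e (by simp [hpf])
  have key : (f ∘ b : unitInterval → E') = a := by
    refine cov'.eq_of_comp_eq (hf.comp b.continuous) a.continuous ?_ 0 (by simp [hb0])
    rw [← Function.comp_assoc, show p' ∘ f = p from funext hpf, hb]
    rfl
  refine ⟨b 1, ?_, ⟨⟨b, hb0, rfl⟩⟩⟩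
  simpa using congrFun key 1

/-! ### The finite Galois covering -/

namespace FlatCocycle

variable {ι B G : Type*} [TopologicalSpace B] [Group G] (Z : FlatCocycle ι B G)

/-- The projection `G → G ⧸ N` as an equivariant map. -/
@[simps]
def mkQuotientHom (N : Subgroup G) : G →[G] G ⧸ N where
  toFun g := (g : G ⧸ N)
  map_smul' _ _ := rfl

/-- Right multiplication on `G ⧸ N` by an element normalizing `N`. -/
def mulRightQuotientHom (N : Subgroup G) (γ : G) (hγ : ∀ n ∈ N, γ⁻¹ * n * γ ∈ N) :
    G ⧸ N →[G] G ⧸ N where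
  toFun := Quotient.map' (· * γ) fun a b hab => by
    rw [QuotientGroup.leftRel_apply] at hab ⊢
    convert hγ _ hab using 1
    group
  map_smul' a q := by
    induction q using QuotientGroup.induction_on with
    | H g => exact congrArg (QuotientGroup.mk (s := N)) (mul_assoc a g γ)

theorem mulRightQuotientHom_mk (N : Subgroup G) (γ : G) (hγ : ∀ n ∈ N, γ⁻¹ * n * γ ∈ N) (g : G) :
    mulRightQuotientHom N γ hγ (g : G ⧸ N) = ((g * γ : G) : G ⧸ N) := rfl

variable [TopologicalSpace G] [DiscreteTopology G]

instance (N : Subgroup G) : DiscreteTopology (G ⧸ N) :=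
  QuotientGroup.discreteTopology (isOpen_discrete _)

/-- The deck transformation of the bundle with fibre `G ⧸ N` given by an element normalizing `N`. -/
def deck (N : Subgroup G) (γ : G) (hγ : ∀ n ∈ N, γ⁻¹ * n * γ ∈ N)
    (hγ' : ∀ n ∈ N, γ * n * γ⁻¹ ∈ N) : Z.AssocSpace (G ⧸ N) ≃ₜ Z.AssocSpace (G ⧸ N) where
  toFun := Z.assocMap (mulRightQuotientHom N γ hγ)
  invFun := Z.assocMap (mulRightQuotientHom N γ⁻¹ (by simpa using hγ'))
  left_inv p := by
    have : ∀ q : G ⧸ N, mulRightQuotientHom N γ⁻¹ (by simpa using hγ')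
        (mulRightQuotientHom N γ hγ q) = q := fun q => by
      induction q using QuotientGroup.induction_on with
      | H g => simp [mulRightQuotientHom_mk]
    exact congrArg (Z.mkAt p.1) (this (Z.val p))
  right_inv p := by
    have : ∀ q : G ⧸ N, mulRightQuotientHom N γ hγ
        (mulRightQuotientHom N γ⁻¹ (by simpa using hγ') q) = q := fun q => by
      induction q using QuotientGroup.induction_on with
      | H g => simp [mulRightQuotientHom_mk]
    exact congrArg (Z.mkAt p.1) (this (Z.val p))
  continuous_toFun := Z.continuous_assocMap _
  continuous_invFun := Z.continuous_assocMap _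

theorem deck_assocMap (N : Subgroup G) (γ : G) (hγ : ∀ n ∈ N, γ⁻¹ * n * γ ∈ N)
    (hγ' : ∀ n ∈ N, γ * n * γ⁻¹ ∈ N) (e : Z.AssocSpace G) :
    Z.deck N γ hγ hγ' (Z.assocMap (mkQuotientHom N) e) =
      Z.assocMap (mkQuotientHom N) (MulOpposite.op γ • e) := rfl

/-- The path component of the bundle with fibre `G ⧸ N` at the class of `e`. -/
abbrev quotientComponent (N : Subgroup G) (e : Z.AssocSpace G) : Type _ :=
  pathComponent (Z.assocMap (mkQuotientHom N) e)

/-- Right translation by `γ ∈ Γ` descends because `Γ` normalizes `N`, and keeps the component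
because `e` is joined to `eγ`. Conversely, two points of the component in one fibre lift to points
`b`, `bγ` joined to `e`, which forces `γ ∈ Γ`. Hence `Γ` is transitive on each fibre, acting through
the finite quotient by `N ∩ Γ`. -/
theorem isFiniteGaloisCover_quotientComponent [ConnectedSpace B] [LocallyPathConnectedSpace B]
    {x : B} (e : π G (Z.assoc G).Fiber ⁻¹' {x}) (N : Subgroup G)
    (hN : ∀ γ ∈ Z.monodromyGroup e, ∀ n ∈ N, γ * n * γ⁻¹ ∈ N)
    (hfin : N.IsFiniteRelIndex (Z.monodromyGroup e)) :
    IsFiniteGaloisCover (fun y : Z.quotientComponent N (e : Z.AssocSpace G) => y.1.1) := by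
  set Γ := Z.monodromyGroup e
  set q₀ := Z.assocMap (mkQuotientHom N) (e : Z.AssocSpace G) with hq₀
  have covP := Z.isCoveringMap_proj G
  have covQ := Z.isCoveringMap_proj (G ⧸ N)
  have : LocallyPathConnectedSpace (Z.AssocSpace (G ⧸ N)) :=
    covQ.isLocalHomeomorph.locallyPathConnectedSpace
  have : PathConnectedSpace B := .of_locallyPathConnectedSpace
  have hN' : ∀ γ ∈ Γ, ∀ n ∈ N, γ⁻¹ * n * γ ∈ N := fun γ hγ n hn => by
    simpa using hN γ⁻¹ (Γ.inv_mem hγ) n hn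
  -- points of the component are images of points joined to `e`
  have lift : ∀ q ∈ pathComponent q₀, ∃ b : Z.AssocSpace G,
      Z.assocMap (mkQuotientHom N) b = q ∧ Joined (e : Z.AssocSpace G) b := fun q hq =>
    covP.joined_of_comp_eq covQ (Z.continuous_assocMap _) (fun _ => rfl) hq
  have deck_mem : ∀ (γ : G) (hγ : γ ∈ Γ) (q : Z.AssocSpace (G ⧸ N)), q ∈ pathComponent q₀ →
      Z.deck N γ (hN' γ hγ) (hN γ hγ) q ∈ pathComponent q₀ := by
    intro γ hγ q hq
    have h1 : Joined q₀ (Z.deck N γ (hN' γ hγ) (hN γ hγ) q₀) := by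
      rw [hq₀, deck_assocMap]
      obtain ⟨a⟩ := (Z.mem_monodromyGroup_iff e γ).1 hγ
      exact ⟨a.map (Z.continuous_assocMap _)⟩
    obtain ⟨a⟩ : Joined q₀ q := hq
    exact h1.trans ⟨a.map (Z.deck N γ (hN' γ hγ) (hN γ hγ)).continuous⟩
  have trans : ∀ q ∈ pathComponent q₀, ∀ q' ∈ pathComponent q₀, q.1 = q'.1 →
      ∃ γ, ∃ hγ : γ ∈ Γ, Z.deck N γ (hN' γ hγ) (hN γ hγ) q = q' := by
    intro q hq q' hq' hqq
    obtain ⟨b, rfl, hb⟩ := lift q hq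
    obtain ⟨b', rfl, hb'⟩ := lift q' hq'
    obtain ⟨γ, rfl⟩ := Z.exists_op_smul_eq (p := b) (q := b') hqq
    refine ⟨γ, (Z.mem_monodromyGroup_iff e γ).2 (hb'.trans ?_), rfl⟩
    obtain ⟨a⟩ := hb.symm
    exact ⟨a.map (Z.continuous_assocMap (mulRightHom γ))⟩
  refine ⟨?_, covQ.restrict_isClopen (IsClopen.pathComponent q₀), ?_, ?_, ?_⟩
  · exact isConnected_iff_connectedSpace.1 isPathConnected_pathComponent.isConnected
  · intro z
    obtain ⟨b, hb, hb0⟩ := covQ.exists_path_lifts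
      (PathConnectedSpace.somePath q₀.1 z).toContinuousMap q₀ (by simp)
    refine ⟨⟨b 1, ⟨⟨b, hb0, rfl⟩⟩⟩, ?_⟩
    simpa using congrFun hb 1
  · intro z
    rcases Set.eq_empty_or_nonempty
      ((fun y : Z.quotientComponent N (e : Z.AssocSpace G) => y.1.1) ⁻¹' {z}) with h | ⟨y, hy⟩
    · rw [h]; exact Set.finite_empty
    have : Finite (Γ ⧸ N.subgroupOf Γ) := by
      have : (N.subgroupOf Γ).FiniteIndex := ⟨hfin.relIndex_ne_zero⟩
      infer_instance
    let f : Γ ⧸ N.subgroupOf Γ → Z.quotientComponent N (e : Z.AssocSpace G) := fun c =>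
      ⟨Z.deck N c.out (hN' _ c.out.2) (hN _ c.out.2) y.1, deck_mem _ c.out.2 _ y.2⟩
    refine (Set.finite_range f).subset fun y' hy' => ?_
    obtain ⟨b, hb, hbe⟩ := lift y.1 y.2
    obtain ⟨γ, hγ, h⟩ := trans y.1 y.2 y'.1 y'.2 (hy.trans hy'.symm)
    refine ⟨((⟨γ, hγ⟩ : Γ) : Γ ⧸ N.subgroupOf Γ), Subtype.ext ?_⟩
    rw [← h]
    change Z.deck N _ _ _ y.1 = _
    set c := (((⟨γ, hγ⟩ : Γ) : Γ ⧸ N.subgroupOf Γ)).out with hc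
    -- The chosen representative `c` may differ from `γ`, but `gcN = gγN` for all `g` since `γ⁻¹c ∈
    -- N`.
    have hcn : γ⁻¹ * (c : G) ∈ N := by
      have := QuotientGroup.eq.1
        (QuotientGroup.out_eq' (((⟨γ, hγ⟩ : Γ) : Γ ⧸ N.subgroupOf Γ))).symm
      simpa [Subgroup.mem_subgroupOf] using this
    rw [← hb]
    refine congrArg (Z.mkAt b.1) (?_ : ((Z.val b * c : G) : G ⧸ N) = ((Z.val b * γ : G) : G ⧸ N))
    refine (QuotientGroup.eq.2 ?_).symm
    simpa [mul_assoc] using hcn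
  · intro y y' h
    obtain ⟨γ, hγ, hd⟩ := trans y.1 y.2 y'.1 y'.2 h
    refine ⟨(Z.deck N γ (hN' γ hγ) (hN γ hγ)).subtype fun q => ⟨deck_mem γ hγ q, fun hq => ?_⟩,
      fun w => rfl, Subtype.ext hd⟩
    have := deck_mem γ⁻¹ (Γ.inv_mem hγ) _ hq
    convert this using 1
    exact ((Z.deck N γ (hN' γ hγ) (hN γ hγ)).symm_apply_apply q).symm

end FlatCocycle

/-! ### Finitely generated abelian groups -/

section AbelianGroups

variable (M : Type*) [AddCommGroup M]

/-- Take `m` to be the order of the torsion subgroup, which is finite: if `k • m • x = 0` then `x`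
is torsion, so `m` kills it. -/
theorem AddCommGroup.exists_nsmul_torsionFree [AddGroup.FG M] :
    ∃ m : ℕ, m ≠ 0 ∧ ∀ (x : M) (k : ℤ), k ≠ 0 → k • m • x = 0 → m • x = 0 := by
  have : Module.Finite ℤ M := Module.Finite.iff_addGroup_fg.2 inferInstance
  have hT : Finite (Submodule.torsion ℤ M) :=
    Module.finite_of_fg_torsion _ (Submodule.torsion_isTorsion)
  refine ⟨Nat.card (Submodule.torsion ℤ M), Nat.card_pos.ne', fun x k hk h => ?_⟩
  set m := Nat.card (Submodule.torsion ℤ M) with hm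
  have hm0 : m ≠ 0 := Nat.card_pos.ne'
  have hx : x ∈ Submodule.torsion ℤ M := by
    refine (Submodule.mem_torsion_iff x).2 ⟨⟨k * m, ?_⟩, ?_⟩
    · exact mem_nonZeroDivisors_of_ne_zero (mul_ne_zero hk (by exact_mod_cast hm0))
    · change (k * (m : ℤ)) • x = 0
      rw [mul_smul, natCast_zsmul, h]
  have := card_nsmul_eq_zero' (x := (⟨x, hx⟩ : Submodule.torsion ℤ M))
  exact congrArg Subtype.val this

/-- The quotient is finitely generated and killed by `m`, hence finite. -/
theorem AddCommGroup.finiteIndex_range_nsmul [AddGroup.FG M] {m : ℕ} (hm : m ≠ 0) :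
    (nsmulAddMonoidHom (α := M) m).range.FiniteIndex := by
  have hfin : Finite (M ⧸ (nsmulAddMonoidHom (α := M) m).range) := by
    refine AddCommGroup.finite_of_fg_isAddTorsion _ fun q => ?_
    induction q using QuotientAddGroup.induction_on with
    | H x =>
      refine isOfFinAddOrder_iff_nsmul_eq_zero.2 ⟨m, Nat.pos_of_ne_zero hm, ?_⟩
      rw [← QuotientAddGroup.mk_nsmul]
      exact (QuotientAddGroup.eq_zero_iff _).2 ⟨x, rfl⟩
  exact AddSubgroup.finiteIndex_of_finite_quotient

/-- On the subgroup of `m`-th multiples, for a suitable `m`, homomorphisms lift along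
surjections. -/
theorem AddCommGroup.exists_lift_range_nsmul [AddGroup.FG M] {R C : Type*} [AddCommGroup R]
    [AddCommGroup C] (f : R →+ C) (hf : Function.Surjective f) (φ : M →+ C) :
    ∃ m : ℕ, m ≠ 0 ∧ ∃ l : (nsmulAddMonoidHom (α := M) m).range →+ R, ∀ x, f (l x) = φ x := by
  obtain ⟨m, hm, hM⟩ := AddCommGroup.exists_nsmul_torsionFree M
  refine ⟨m, hm, ?_⟩
  set A := (nsmulAddMonoidHom (α := M) m).range
  have : Module.Finite ℤ M := Module.Finite.iff_addGroup_fg.2 inferInstance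
  have : AddGroup.FG A := inferInstanceAs (AddGroup.FG (nsmulAddMonoidHom (α := M) m).range)
  have : Module.Finite ℤ A := Module.Finite.iff_addGroup_fg.2 inferInstance
  have : Module.IsTorsionFree ℤ A := by
    refine Module.isTorsionFree_iff_smul_eq_zero.2 ?_
    rintro k ⟨_, x, rfl⟩ h
    by_cases hk : k = 0
    · exact Or.inl hk
    · exact Or.inr (Subtype.ext (hM x k hk (congrArg Subtype.val h)))
  -- Finitely generated and torsion-free over `ℤ` implies free, hence projective.
  have : Module.Free ℤ A := inferInstance
  obtain ⟨l, hl⟩ := Module.projective_lifting_property f.toIntLinearMap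
    (φ.comp A.subtype).toIntLinearMap hf
  exact ⟨l.toAddMonoidHom, fun x => LinearMap.congr_fun hl x⟩

end AbelianGroups

/-! ### Finitely generated subgroups of `O(2)` -/

theorem rotation_mem_range_or (f : O2) : f ∈ rotation.range ∨
    f * Complex.conjLIE ∈ rotation.range := by
  obtain ⟨a, rfl | rfl⟩ := linear_isometry_complex f
  · exact Or.inl ⟨a, rfl⟩
  · refine Or.inr ⟨a, ?_⟩
    ext z
    change rotation a z = rotation a (Complex.conjLIE (Complex.conjLIE z))
    simp

theorem index_range_rotation : (rotation.range : Subgroup O2).index = 2 := by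
  rw [Subgroup.index_eq_two_iff]
  refine ⟨Complex.conjLIE, fun b => ?_⟩
  rcases rotation_mem_range_or b with h | h
  · refine Or.inr ⟨h, fun h' => ?_⟩
    obtain ⟨a, ha⟩ := (Subgroup.mul_mem_cancel_left _ h).1 h'
    exact rotation_ne_conjLIE a ha
  · refine Or.inl ⟨h, fun h' => ?_⟩
    obtain ⟨a, ha⟩ := (Subgroup.mul_mem_cancel_left _ h').1 h
    exact rotation_ne_conjLIE a ha

/-- A finitely generated subgroup of `O(2)` has a normal subgroup of finite index consisting of
rotations whose angles can be chosen additively. -/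
theorem exists_additive_angle (Γ : Subgroup O2) (hfg : Group.FG Γ) :
    ∃ N : Subgroup O2, (∀ γ ∈ Γ, ∀ n ∈ N, γ * n * γ⁻¹ ∈ N) ∧ N.IsFiniteRelIndex Γ ∧
      ∃ l : N →* Multiplicative ℝ, ∀ n, rotation (Circle.exp (l n).toAdd) = n := by
  have hR : (rotation.range : Subgroup O2).FiniteIndex := ⟨by simp [index_range_rotation]⟩
  have hRn : (rotation.range : Subgroup O2).Normal :=
    Subgroup.normal_of_index_eq_two index_range_rotation
  set C : Subgroup Circle := Γ.comap rotation with hC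
  have hCrot : C.map rotation = Γ ⊓ rotation.range := by
    rw [hC, Subgroup.map_comap_eq, inf_comm]
  have hCfg : Group.FG C := by
    have h1 : Group.FG ((rotation.range : Subgroup O2).subgroupOf Γ) := inferInstance
    let f : C →* (rotation.range : Subgroup O2).subgroupOf Γ :=
      { toFun := fun a => ⟨⟨rotation a, a.2⟩, ⟨a, rfl⟩⟩
        map_one' := by ext; simp
        map_mul' := fun a b => by ext; simp }
    have hf : Function.Bijective f := by
      refine ⟨fun a b h => Subtype.ext (rotation_injective ?_), ?_⟩
      · exact congrArg (fun x => (x.1.1 : O2)) h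
      · rintro ⟨⟨g, hg⟩, ⟨a, ha⟩⟩
        have ha' : rotation a = g := ha
        exact ⟨⟨a, show rotation a ∈ Γ from ha' ▸ hg⟩, Subtype.ext (Subtype.ext ha')⟩
    exact Group.fg_of_surjective (f := (MulEquiv.ofBijective f hf).symm.toMonoidHom)
      (MulEquiv.ofBijective f hf).symm.surjective
  have : AddGroup.FG (Additive C) := inferInstance
  -- The inclusion of `C` in the circle is lifted through `ℝ → S¹` on `m`-th powers; torsion, i.e.
  -- roots of unity, would obstruct this.
  obtain ⟨m, hm, l, hl⟩ := AddCommGroup.exists_lift_range_nsmul (Additive C) Circle.expHom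
    (fun z => Circle.exp_surjective z.toMul) (MonoidHom.toAdditive C.subtype)
  have hidx := AddCommGroup.finiteIndex_range_nsmul (Additive C) hm
  let P : Subgroup C := (powMonoidHom (α := C) m).range
  have hP : P.index ≠ 0 := hidx.index_ne_zero
  let l' : P →* Multiplicative ℝ :=
    { toFun := fun p => Multiplicative.ofAdd (l ⟨Additive.ofMul p.1, p.2⟩)
      map_one' := l.map_zero
      map_mul' := fun p q => l.map_add ⟨Additive.ofMul p.1, p.2⟩ ⟨Additive.ofMul q.1, q.2⟩ }
  have hl' : ∀ p : P, Circle.exp (l' p).toAdd = p.1.1 := fun p => hl ⟨Additive.ofMul p.1, p.2⟩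
  let r : C →* O2 := rotation.comp C.subtype
  have hr : Function.Injective r := rotation_injective.comp Subtype.val_injective
  let e := P.equivMapOfInjective r hr
  refine ⟨P.map r, ?_, ⟨?_⟩, l'.comp e.symm.toMonoidHom, fun n => ?_⟩
  · rintro γ hγ _ ⟨_, ⟨a, rfl⟩, rfl⟩
    have h1 : γ * rotation a * γ⁻¹ ∈ Γ ⊓ rotation.range :=
      ⟨Γ.mul_mem (Γ.mul_mem hγ a.2) (Γ.inv_mem hγ), hRn.conj_mem _ ⟨_, rfl⟩ γ⟩
    rw [← hCrot] at h1
    obtain ⟨b, hb, hb'⟩ := h1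
    -- Conjugation preserves `m`-th powers; an arbitrary free complement of the torsion need not be
    -- normalized by `Γ`.
    refine ⟨(⟨b, hb⟩ : C) ^ m, ⟨⟨b, hb⟩, rfl⟩, ?_⟩
    change r ((⟨b, hb⟩ : C) ^ m) = γ * r (a ^ m) * γ⁻¹
    rw [map_pow, map_pow, ← conj_pow]
    exact congrArg (· ^ m) hb'
  · have h1 : P.map r = (P.map C.subtype).map rotation := by rw [Subgroup.map_map]
    have h2 : P.map r ≤ Γ ⊓ rotation.range := by
      rw [h1, ← hCrot]
      exact Subgroup.map_mono (Subgroup.map_subtype_le P)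
    -- The index factors through the rotations in `Γ`: the first factor is the index of the `m`-th
    -- powers in `C`, the second is finite because rotations have index 2 in `O(2)`.
    rw [← Subgroup.relIndex_mul_relIndex _ _ _ h2 inf_le_left]
    refine mul_ne_zero ?_ ?_
    · rw [h1, ← hCrot, Subgroup.relIndex_map_map_of_injective _ _ rotation_injective,
        Subgroup.relIndex, Subgroup.subgroupOf,
        Subgroup.comap_map_eq_self_of_injective C.subtype_injective]
      exact hP
    · rw [Subgroup.inf_relIndex_left]
      exact (inferInstance : ((rotation.range : Subgroup O2).subgroupOf Γ).FiniteIndex).index_ne_zero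
  · obtain ⟨p, rfl⟩ := e.surjective n
    change rotation (Circle.exp (l' (e.symm (e p))).toAdd) = r p
    rw [e.symm_apply_apply, hl']
    rfl

/-- An additive function on a subgroup extends equivariantly to the whole group. -/
theorem Subgroup.exists_equivariant_extension {G A : Type*} [Group G] [CommGroup A]
    (N : Subgroup G) (l : N →* A) : ∃ L : G → A, ∀ (g : G) (n : N), L (g * n) = L g * l n := by
  -- With `r` the chosen representative of `gN`, set `L g = l (r⁻¹g)`; replacing `g` by `gn` keeps
  -- `r`.
  have hmem : ∀ g : G, ((g : G ⧸ N).out)⁻¹ * g ∈ N := fun g =>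
    QuotientGroup.eq.1 (QuotientGroup.out_eq' (g : G ⧸ N))
  refine ⟨fun g => l ⟨_, hmem g⟩, fun g n => ?_⟩
  rw [← map_mul]
  refine congrArg l (Subtype.ext ?_)
  have h : ((g * n : G) : G ⧸ N) = g := (QuotientGroup.mk_mul_of_mem g n.2)
  simp [h, mul_assoc]

/-! ### Averaging the angle function -/

section AngleFunction

variable {ι B G : Type*} [TopologicalSpace B] [Group G] [TopologicalSpace G] [DiscreteTopology G]

/-- On the principal bundle of a flat cocycle, functions on the fibre that are equivariant under a
subgroup can be averaged to continuous equivariant functions. -/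
theorem FlatCocycle.exists_continuous_equivariant [T2Space B] [ParacompactSpace B]
    (Z : FlatCocycle ι B G) (N : Subgroup G) (l : N → ℝ) (L : G → ℝ)
    (hL : ∀ (g : G) (n : N), L (g * n) = L g + l n) :
    ∃ f : Z.AssocSpace G → ℝ, Continuous f ∧
      ∀ (n : N) (b : Z.AssocSpace G), f (MulOpposite.op (n : G) • b) = f b + l n := by
  obtain ⟨ρ, hρ⟩ := PartitionOfUnity.exists_isSubordinate (isClosed_univ (X := B)) Z.baseSet
    Z.isOpen_baseSet (fun x _ => Set.mem_iUnion.2 ⟨_, Z.mem_baseSet_at x⟩)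
  have hproj : Continuous (π G (Z.assoc G).Fiber) := (Z.assoc G).continuous_proj
  -- Every local candidate `L (Z.coord j b)` shifts by the same `l n`, and the weights sum to one.
  refine ⟨fun b => ∑ᶠ j, ρ j b.1 * L (Z.coord j b), ?_, fun n b => ?_⟩
  · refine continuous_finsum (fun j => continuous_iff_continuousAt.2 fun b => ?_) ?_
    · by_cases hb : b.1 ∈ Z.baseSet j
      · refine ((ρ j).continuous.comp hproj).continuousAt.mul ?_
        refine continuousAt_const.congr (f := fun _ => L (Z.coord j b)) ?_
        filter_upwards [Z.eventually_coord_eq j b hb] with q hq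
        rw [hq.2]
      · have hb' : b.1 ∉ tsupport (ρ j) := fun h => hb (hρ j h)
        have h0 : ∀ᶠ q in 𝓝 b, ρ j q.1 = 0 :=
          hproj.continuousAt.eventually (notMem_tsupport_iff_eventuallyEq.1 hb')
        refine continuousAt_const.congr (f := fun _ => (0 : ℝ)) ?_
        filter_upwards [h0] with q hq
        rw [hq, zero_mul]
    · refine (ρ.locallyFinite.preimage_continuous hproj).subset fun j b hb => ?_
      exact left_ne_zero_of_mul hb
  · have hfin : ∀ c : ι → ℝ, (Function.support fun j => ρ j b.1 * c j).Finite := fun c =>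
      (ρ.locallyFinite.point_finite b.1).subset fun j hj => left_ne_zero_of_mul hj
    have h1 : ∀ j, Z.coord j (MulOpposite.op (n : G) • b) = Z.coord j b * n := fun j =>
      Z.coord_assocMap (FlatCocycle.mulRightHom (n : G)) j b
    calc ∑ᶠ j, ρ j b.1 * L (Z.coord j (MulOpposite.op (n : G) • b))
        = ∑ᶠ j, (ρ j b.1 * L (Z.coord j b) + ρ j b.1 * l n) := by
          refine finsum_congr fun j => ?_
          rw [h1, hL, mul_add]
      _ = _ := by
          rw [finsum_add_distrib (hfin _) (hfin _), ← finsum_mul, ρ.sum_eq_one trivial, one_mul]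

end AngleFunction

/-! ### The action of `O(2)` on the circle -/

namespace O2

/-- The action of `O(2)` on the unit circle. -/
noncomputable def circleAct (g : O2) (z : Circle) : Circle :=
  ⟨g z, mem_sphere_zero_iff_norm.2 (by rw [g.norm_map, Circle.norm_coe])⟩

@[simp] theorem coe_circleAct (g : O2) (z : Circle) : (circleAct g z : ℂ) = g z := rfl

theorem circleAct_mul (g h : O2) (z : Circle) :
    circleAct (g * h) z = circleAct g (circleAct h z) := rfl

@[simp] theorem circleAct_one (z : Circle) : circleAct 1 z = z := rfl

theorem circleAct_rotation (a z : Circle) : circleAct (rotation a) z = a * z := rfl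

theorem continuous_circleAct (g : O2) : Continuous (circleAct g) :=
  Continuous.subtype_mk (g.continuous.comp continuous_subtype_val) _

@[simp] theorem circleAct_inv_circleAct (g : O2) (z : Circle) :
    circleAct g⁻¹ (circleAct g z) = z := by
  rw [← circleAct_mul, inv_mul_cancel, circleAct_one]

@[simp] theorem circleAct_circleAct_inv (g : O2) (z : Circle) :
    circleAct g (circleAct g⁻¹ z) = z := by
  rw [← circleAct_mul, mul_inv_cancel, circleAct_one]

/-- The circle spans the plane over `ℝ`. -/
theorem circleAct_injective : Function.Injective circleAct := by
  intro g h hgh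
  ext z
  have h1 : ∀ w : Circle, g w = h w := fun w => congrArg Subtype.val (congrFun hgh w)
  have hz : z = ‖z‖ • ((Circle.exp z.arg : Circle) : ℂ) := by
    rw [Circle.coe_exp, Complex.real_smul, Complex.norm_mul_exp_arg_mul_I]
  rw [hz, map_smul, map_smul, h1]

end O2

/-! ### Trivializing the pulled-back circle bundle -/

section FlatBundle

variable {X : Type*} [TopologicalSpace X] {E : X → Type*} [∀ x, TopologicalSpace (E x)]
  [TopologicalSpace (TotalSpace Circle E)] [FiberBundle Circle E]

open O2

open Classical in
/-- The transition cocycle of a flat circle bundle. -/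
noncomputable def IsFlatO2CircleBundle.cocycle (hE : IsFlatO2CircleBundle E) :
    FlatCocycle (trivializationAtlas Circle E) X O2 where
  baseSet e := e.1.baseSet
  isOpen_baseSet e := e.1.open_baseSet
  indexAt x := ⟨trivializationAt Circle E x, trivialization_mem_atlas Circle E x⟩
  mem_baseSet_at x := mem_baseSet_trivializationAt Circle E x
  trans e e' x :=
    -- The choice is forced, since an element of `O(2)` is determined by its action on the circle;
    -- off the overlap the value 1 is arbitrary.
    if h : x ∈ e.1.baseSet ∩ e'.1.baseSet then (hE e.1 e.2 e'.1 e'.2 x h).choose else 1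
  trans_self e x hx := by
    rw [dif_pos ⟨hx, hx⟩]
    refine circleAct_injective (funext fun z => Subtype.ext ?_)
    have := (hE e.1 e.2 e.1 e.2 x ⟨hx, hx⟩).choose_spec.self_of_nhds z
    rw [coe_circleAct, ← this, e.1.coordChange_same_apply hx]
    rfl
  trans_mul_trans e e' e'' x hx := by
    obtain ⟨⟨h, h'⟩, h''⟩ := hx
    rw [dif_pos ⟨h', h''⟩, dif_pos ⟨h, h'⟩, dif_pos ⟨h, h''⟩]
    refine circleAct_injective (funext fun z => ?_)
    have key : ∀ (e e' : trivializationAtlas Circle E) (hx : x ∈ e.1.baseSet ∩ e'.1.baseSet)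
        (z : Circle), circleAct (hE e.1 e.2 e'.1 e'.2 x hx).choose z = e.1.coordChange e'.1 x z :=
      fun e e' hx z =>
        Subtype.ext ((hE e.1 e.2 e'.1 e'.2 x hx).choose_spec.self_of_nhds z).symm
    rw [circleAct_mul, key _ _ ⟨h, h'⟩, key _ _ ⟨h', h''⟩, key _ _ ⟨h, h''⟩,
      e.1.coordChange_coordChange _ _ h h']
  eventually_trans_eq e e' x hx := by
    have ho : ∀ᶠ y in 𝓝 x, y ∈ e.1.baseSet ∩ e'.1.baseSet :=
      (e.1.open_baseSet.inter e'.1.open_baseSet).mem_nhds hx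
    filter_upwards [ho, (hE e.1 e.2 e'.1 e'.2 x hx).choose_spec] with y hy hy'
    rw [dif_pos hy, dif_pos hx]
    refine circleAct_injective (funext fun z => Subtype.ext ?_)
    rw [coe_circleAct, coe_circleAct, ← hy',
      ← (hE e.1 e.2 e'.1 e'.2 y hy).choose_spec.self_of_nhds]

theorem IsFlatO2CircleBundle.circleAct_trans (hE : IsFlatO2CircleBundle E)
    (e e' : trivializationAtlas Circle E) {x : X} (hx : x ∈ e.1.baseSet ∩ e'.1.baseSet)
    (z : Circle) : circleAct (hE.cocycle.trans e e' x) z = e.1.coordChange e'.1 x z := by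
  have h : hE.cocycle.trans e e' x = (hE e.1 e.2 e'.1 e'.2 x hx).choose := dif_pos hx
  rw [h]
  exact Subtype.ext ((hE e.1 e.2 e'.1 e'.2 x hx).choose_spec.self_of_nhds z).symm

theorem IsFlatO2CircleBundle.isO2CircleBundle (hE : IsFlatO2CircleBundle E) :
    IsO2CircleBundle E := fun e he e' he' x hx => by
  obtain ⟨g, hg⟩ := hE e he e' he' x hx
  exact ⟨g, hg.self_of_nhds⟩

variable [∀ x, Nonempty (E x)] {Y : Type*} [TopologicalSpace Y] (p : C(Y, X))

omit [∀ x, TopologicalSpace (E x)] [FiberBundle Circle E] in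
theorem Bundle.Trivialization.coordChange_pullback
    (e e' : Trivialization Circle (π Circle E)) {y : Y} (hy : p y ∈ e.baseSet) (z : Circle) :
    (e.pullback p).coordChange (e'.pullback p) y z = e.coordChange e' (p y) z := by
  have : e.toOpenPartialHomeomorph.symm (p y, z) = TotalSpace.mk (p y) (e.symm (p y) z) :=
    (e.mk_symm hy z).symm
  rw [Trivialization.coordChange, Trivialization.coordChange, this]
  rfl

theorem IsO2CircleBundle.pullback (hE : IsO2CircleBundle E) : IsO2CircleBundle (p *ᵖ E) := by
  rintro _ ⟨e, he, rfl⟩ _ ⟨e', he', rfl⟩ y hy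
  obtain ⟨g, hg⟩ := hE e he.out e' he'.out (p y) hy
  refine ⟨g, fun z => ?_⟩
  rw [← hg, e.coordChange_pullback p e' hy.1]

/-- A gauge, i.e. a family of continuous `O(2)`-valued functions compatible with the transition
functions, trivializes the pullback bundle. -/
theorem isTrivialO2CircleBundle_pullback_of_gauge (hE : IsO2CircleBundle E)
    (h : trivializationAtlas Circle E → Y → O2)
    (hcompat : ∀ e e' : trivializationAtlas Circle E, ∀ y, p y ∈ e.1.baseSet → p y ∈ e'.1.baseSet →
      ∀ z, circleAct (h e' y) (e.1.coordChange e'.1 (p y) z) = circleAct (h e y) z)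
    (hcont : ∀ (e : trivializationAtlas Circle E) y z, p y ∈ e.1.baseSet →
      ContinuousAt (fun w : Y × Circle => circleAct (h e w.1) w.2) (y, z))
    (hcont' : ∀ (e : trivializationAtlas Circle E) y z, p y ∈ e.1.baseSet →
      ContinuousAt (fun w : Y × Circle => circleAct (h e w.1)⁻¹ w.2) (y, z)) :
    IsTrivialO2CircleBundle (p *ᵖ E) := by
  refine ⟨hE.pullback p, ?_⟩
  let T := TotalSpace Circle (p *ᵖ E)
  let c : Y → trivializationAtlas Circle E := fun y =>
    ⟨trivializationAt Circle E (p y), trivialization_mem_atlas Circle E (p y)⟩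
  have hc : ∀ y, p y ∈ (c y).1.baseSet := fun y => mem_baseSet_trivializationAt Circle E (p y)
  let φ : T → Y × Circle := fun v =>
    (v.proj, circleAct (h (c v.proj) v.proj) (((c v.proj).1.pullback p) v).2)
  let ψ : Y × Circle → T := fun w =>
    ((c w.1).1.pullback p).toOpenPartialHomeomorph.symm (w.1, circleAct (h (c w.1) w.1)⁻¹ w.2)
  -- The gauge condition makes the formula independent of the chart, so continuity can be checked in
  -- one fixed chart near each point.
  have hφ : ∀ (e : trivializationAtlas Circle E) (v : T), p v.proj ∈ e.1.baseSet →
      φ v = (v.proj, circleAct (h e v.proj) ((e.1.pullback p) v).2) := by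
    intro e v hv
    refine Prod.ext rfl ?_
    change circleAct (h (c v.proj) v.proj) _ = circleAct (h e v.proj) _
    rw [← hcompat (c v.proj) e v.proj (hc _) hv]
    congr 1
    have := ((c v.proj).1.pullback p).coordChange_apply_snd (e.1.pullback p)
      (p := v) (hc v.proj)
    rw [← this, (c v.proj).1.coordChange_pullback p e.1 (hc _)]
  have hψ_mem : ∀ (e : trivializationAtlas Circle E) (w : Y × Circle), p w.1 ∈ e.1.baseSet →
      w ∈ (e.1.pullback p).target := fun e w hw => (e.1.pullback p).mem_target.2 hw
  have hφψ : ∀ (e : trivializationAtlas Circle E) (w : Y × Circle), p w.1 ∈ e.1.baseSet →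
      φ ((e.1.pullback p).toOpenPartialHomeomorph.symm (w.1, circleAct (h e w.1)⁻¹ w.2)) = w := by
    intro e w hw
    have hproj : ((e.1.pullback p).toOpenPartialHomeomorph.symm
        (w.1, circleAct (h e w.1)⁻¹ w.2)).proj = w.1 := (e.1.pullback p).proj_symm_apply' hw
    rw [hφ e _ (by rw [hproj]; exact hw), (e.1.pullback p).apply_symm_apply' hw, hproj]
    simp
  have hφinj : Function.Injective φ := by
    intro v v' hv
    have h1 : v.proj = v'.proj := congrArg Prod.fst hv
    have hv' : p v'.proj ∈ (c v.proj).1.baseSet := h1 ▸ hc v.proj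
    rw [hφ (c v.proj) v (hc _), hφ (c v.proj) v' hv', ← h1] at hv
    have h2 := congrArg (circleAct (h (c v.proj) v.proj)⁻¹) (congrArg Prod.snd hv)
    simp only [circleAct_inv_circleAct] at h2
    refine ((c v.proj).1.pullback p).injOn
      (((c v.proj).1.pullback p).mem_source.2 (hc v.proj))
      (((c v.proj).1.pullback p).mem_source.2 hv') (Prod.ext h1 h2)
  have hψ : ∀ (e : trivializationAtlas Circle E) (w : Y × Circle), p w.1 ∈ e.1.baseSet →
      ψ w = (e.1.pullback p).toOpenPartialHomeomorph.symm (w.1, circleAct (h e w.1)⁻¹ w.2) :=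
    fun e w hw => hφinj ((hφψ (c w.1) w (hc _)).trans (hφψ e w hw).symm)
  have hproj : Continuous (π Circle (p *ᵖ E)) := FiberBundle.continuous_proj Circle _
  have hφc : Continuous φ := by
    refine continuous_iff_continuousAt.2 fun v => ?_
    set e := c v.proj with he
    have hbase : ∀ᶠ v' in 𝓝 v, p v'.proj ∈ e.1.baseSet :=
      ((e.1.open_baseSet.preimage p.continuous).preimage hproj).mem_nhds (hc v.proj)
    refine ContinuousAt.congr ?_ (hbase.mono fun v' hv' => (hφ e v' hv').symm)
    refine hproj.continuousAt.prodMk ?_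
    exact ContinuousAt.comp (f := fun v' : T => (v'.proj, ((e.1.pullback p) v').2))
      (hcont e v.proj _ (hc _)) (hproj.continuousAt.prodMk (continuous_snd.continuousAt.comp
        ((e.1.pullback p).continuousAt ((e.1.pullback p).mem_source.2 (hc v.proj)))))
  have hψc : Continuous ψ := by
    refine continuous_iff_continuousAt.2 fun w => ?_
    set e := c w.1 with he
    have hbase : ∀ᶠ w' in 𝓝 w, p w'.1 ∈ e.1.baseSet :=
      ((e.1.open_baseSet.preimage p.continuous).preimage continuous_fst).mem_nhds (hc w.1)
    refine ContinuousAt.congr ?_ (hbase.mono fun w' hw' => (hψ e w' hw').symm)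
    refine ContinuousAt.comp (f := fun w' : Y × Circle => (w'.1, circleAct (h e w'.1)⁻¹ w'.2))
      ((e.1.pullback p).toOpenPartialHomeomorph.continuousAt_symm (hψ_mem e _ (hc w.1)))
      (continuous_fst.continuousAt.prodMk (hcont' e w.1 w.2 (hc w.1)))
  let Φ : T ≃ₜ Y × Circle :=
    { toFun := φ
      invFun := ψ
      left_inv := fun v => hφinj (hφψ (c (φ v).1) (φ v) (hc _))
      right_inv := fun w => hφψ (c w.1) w (hc _)
      continuous_toFun := hφc
      continuous_invFun := hψc }
  let t : Trivialization Circle (π Circle (p *ᵖ E)) :=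
    { Φ.toOpenPartialHomeomorph with
      baseSet := Set.univ
      open_baseSet := isOpen_univ
      source_eq := rfl
      target_eq := Set.univ_prod_univ.symm
      proj_toFun := fun _ _ => rfl }
  refine ⟨t, rfl, ?_⟩
  rintro _ ⟨e, he, rfl⟩ y hy
  refine ⟨h ⟨e, he.out⟩ y, fun z => ?_⟩
  have hproj' : ((e.pullback p).toOpenPartialHomeomorph.symm (y, z)).proj = y :=
    (e.pullback p).proj_symm_apply' hy.1
  have h1 : (e.pullback p).coordChange t y z = circleAct (h ⟨e, he.out⟩ y) z := by
    change (φ ((e.pullback p).toOpenPartialHomeomorph.symm (y, z))).2 = _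
    rw [hφ ⟨e, he.out⟩ _ (by rw [hproj']; exact hy.1)]
    change circleAct (h ⟨e, he.out⟩ _) ((e.pullback p) _).2 = _
    rw [hproj', (e.pullback p).apply_symm_apply' hy.1]
  rw [h1, coe_circleAct]

/-- The pullback of a flat circle bundle to a space over the associated bundle with fibre
`O(2) ⧸ N` is trivial if `N` consists of rotations whose angles can be chosen additively. -/
theorem IsFlatO2CircleBundle.isTrivialO2CircleBundle_pullback [T2Space X] [ParacompactSpace X]
    [TopologicalSpace O2] [DiscreteTopology O2] (hE : IsFlatO2CircleBundle E) (N : Subgroup O2)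
    (l : N →* Multiplicative ℝ) (hl : ∀ n, rotation (Circle.exp (l n).toAdd) = n)
    (q : Y → hE.cocycle.AssocSpace (O2 ⧸ N)) (hq : Continuous q) (hp : ∀ y, (q y).1 = p y) :
    IsTrivialO2CircleBundle (p *ᵖ E) := by
  let Z := hE.cocycle
  obtain ⟨L, hL⟩ := N.exists_equivariant_extension l
  obtain ⟨f, hf, hfN⟩ := Z.exists_continuous_equivariant N (fun n => (l n).toAdd)
    (fun g => (L g).toAdd) (fun g n => congrArg Multiplicative.toAdd (hL g n))
  -- In the chart `e`, a coset representative `g` lifts `q y` to the principal bundle, and `θ` is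
  -- the angle there. Replacing `g` by `gn` adds `l n` to `θ`, so `exp(iθ) g⁻¹` becomes `exp(iθ) n
  -- n⁻¹ g⁻¹` and is unchanged: this is the gauge.
  let g : trivializationAtlas Circle E → Y → O2 := fun e y => (Z.coord e (q y)).out
  let θ : trivializationAtlas Circle E → Y → ℝ := fun e y => f (Z.point e (p y) (g e y))
  have hloc : ∀ (e : trivializationAtlas Circle E) y, p y ∈ e.1.baseSet →
      ∀ᶠ y' in 𝓝 y, g e y' = g e y := by
    intro e y hy
    have h1 := hq.continuousAt.eventually (Z.eventually_coord_eq e (q y) (by rw [hp]; exact hy))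
    filter_upwards [h1] with y' hy'
    change (Z.coord e (q y')).out = _
    rw [hy'.2]
  have hθ : ∀ (e : trivializationAtlas Circle E) y, p y ∈ e.1.baseSet → ContinuousAt (θ e) y := by
    intro e y hy
    have h1 : ContinuousAt (fun y' => f (Z.point e (p y') (g e y))) y := by
      have h2 : ContinuousAt (fun x => Z.point e x (g e y)) (p y) :=
        (Z.continuousOn_point e (g e y)).continuousAt (e.1.open_baseSet.mem_nhds hy)
      exact (hf.continuousAt.comp h2).comp p.continuous.continuousAt
    refine h1.congr ((hloc e y hy).mono fun y' hy' => ?_)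
    simp only [θ, hy']
  have hexp : ∀ (e : trivializationAtlas Circle E) (y : Y) (z : Circle), p y ∈ e.1.baseSet →
      ContinuousAt (fun w : Y × Circle => Circle.exp (θ e w.1)) (y, z) := fun e y z hy =>
    ContinuousAt.comp (g := Circle.exp ∘ θ e) (f := Prod.fst)
      (Circle.exp.continuous.continuousAt.comp (hθ e y hy)) continuous_fst.continuousAt
  refine isTrivialO2CircleBundle_pullback_of_gauge p hE.isO2CircleBundle
    (fun e y => rotation (Circle.exp (θ e y)) * (g e y)⁻¹) ?_ ?_ ?_
  · intro e e' y hy hy' z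
    rw [← hE.circleAct_trans e e' ⟨hy, hy'⟩, ← circleAct_mul]
    congr 1
    set t := Z.trans e e' (p y) with ht
    have hqe : ((g e y : O2) : O2 ⧸ N) = Z.coord e (q y) := QuotientGroup.out_eq' _
    have hqe' : ((g e' y : O2) : O2 ⧸ N) = Z.coord e' (q y) := QuotientGroup.out_eq' _
    -- Both `g e' y` and `t * g e y` represent the coset of `q y` in the chart `e'`.
    have hn : (g e' y)⁻¹ * (t * g e y) ∈ N := by
      refine QuotientGroup.eq.1 ?_
      rw [hqe', Z.coord_eq_trans_smul (q y) (i := e) (j := e') (by rw [hp]; exact hy)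
        (by rw [hp]; exact hy'), ← hqe, hp]
      rfl
    have h1 : Z.point e (p y) (g e y) = MulOpposite.op ((g e' y)⁻¹ * (t * g e y)) •
        Z.point e' (p y) (g e' y) := by
      rw [Z.op_smul_def, Z.assocMap_point, FlatCocycle.mulRightHom_apply, mul_inv_cancel_left]
      have := Z.point_coord (i := e') (Z.point e (p y) (g e y)) hy'
      rw [Z.coord_point hy hy', Z.point_proj] at this
      exact this.symm
    have h2 : θ e y = θ e' y + (l ⟨_, hn⟩).toAdd := by
      change f (Z.point e (p y) (g e y)) = _
      rw [h1]
      exact hfN ⟨_, hn⟩ _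
    change rotation (Circle.exp (θ e' y)) * (g e' y)⁻¹ * t =
      rotation (Circle.exp (θ e y)) * (g e y)⁻¹
    rw [h2, Circle.exp_add, map_mul, hl]
    group
  · intro e y z hy
    have h1 : ContinuousAt (fun w : Y × Circle => Circle.exp (θ e w.1) *
        circleAct (g e y)⁻¹ w.2) (y, z) :=
      (hexp e y z hy).mul ((continuous_circleAct _).comp continuous_snd).continuousAt
    refine h1.congr ?_
    filter_upwards [continuous_fst.continuousAt.eventually (hloc e y hy)] with w hw
    rw [hw]
    rfl
  · intro e y z hy
    have h1 : ContinuousAt (fun w : Y × Circle => circleAct (g e y)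
        ((Circle.exp (θ e w.1))⁻¹ * w.2)) (y, z) :=
      (continuous_circleAct _).continuousAt.comp
        ((hexp e y z hy).inv.mul continuous_snd.continuousAt)
    refine h1.congr ?_
    filter_upwards [continuous_fst.continuousAt.eventually (hloc e y hy)] with w hw
    rw [hw, mul_inv_rev, inv_inv, circleAct_mul, ← map_inv rotation, circleAct_rotation]

end FlatBundle

/-! ### Fundamental groups of products, circles and regular coverings -/

section FundamentalGroup

open Path.Homotopic

/-- A homeomorphism induces an isomorphism of fundamental groups. -/
theorem Homeomorph.nonempty_fundamentalGroup_mulEquiv {A B : Type*} [TopologicalSpace A]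
    [TopologicalSpace B] (h : A ≃ₜ B) (a : A) :
    Nonempty (FundamentalGroup A a ≃* FundamentalGroup B (h a)) := by
  refine ⟨MulEquiv.ofBijective (FundamentalGroup.map ⟨h, h.continuous⟩ a) ⟨?_, ?_⟩⟩
  · have key : ∀ γ : FundamentalGroup A a, Path.Homotopic.Quotient.cast
        (Path.Homotopic.Quotient.map (FundamentalGroup.map ⟨h, h.continuous⟩ a γ)
          (⟨h.symm, h.symm.continuous⟩ : C(B, A)))
        (h.symm_apply_apply a).symm (h.symm_apply_apply a).symm = γ := by
      rintro ⟨γ⟩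
      refine congrArg Path.Homotopic.Quotient.mk (Path.ext (funext fun t => ?_))
      exact h.symm_apply_apply (γ t)
    intro γ γ' hγ
    rw [← key γ, hγ, key γ']
  · rintro ⟨γ⟩
    refine ⟨.mk ((γ.map h.symm.continuous).cast (by simp) (by simp)), ?_⟩
    refine congrArg Path.Homotopic.Quotient.mk ?_
    ext t
    simp

theorem nonempty_fundamentalGroup_prod_mulEquiv {A B : Type*} [TopologicalSpace A]
    [TopologicalSpace B] (a : A) (b : B) :
    Nonempty (FundamentalGroup (A × B) (a, b) ≃* FundamentalGroup A a × FundamentalGroup B b) := by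
  refine ⟨MulEquiv.ofBijective ((FundamentalGroup.map ⟨Prod.fst, continuous_fst⟩ (a, b)).prod
    (FundamentalGroup.map ⟨Prod.snd, continuous_snd⟩ (a, b))) ⟨fun γ γ' h => ?_, ?_⟩⟩
  · have h1 : projLeft (γ : Path.Homotopic.Quotient (a, b) (a, b)) =
        projLeft (γ' : Path.Homotopic.Quotient (a, b) (a, b)) :=
      congrArg Prod.fst h
    have h2 : projRight (γ : Path.Homotopic.Quotient (a, b) (a, b)) =
        projRight (γ' : Path.Homotopic.Quotient (a, b) (a, b)) :=
      congrArg Prod.snd h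
    rw [← prod_projLeft_projRight (γ : Path.Homotopic.Quotient (a, b) (a, b)), h1, h2,
      prod_projLeft_projRight]
  · rintro ⟨α, β⟩
    exact ⟨Path.Homotopic.prod (α : Path.Homotopic.Quotient a a) (β : Path.Homotopic.Quotient b b),
      Prod.ext (projLeft_prod _ _) (projRight_prod _ _)⟩

/-- The line is simply connected and covers the circle by `Circle.exp` with deck group `2πℤ`. -/
theorem Circle.nonempty_fundamentalGroup_mulEquiv (z : Circle) :
    Nonempty (FundamentalGroup Circle z ≃* Multiplicative ℤ) := by
  obtain ⟨x, hx⟩ := Circle.exp_surjective z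
  let e := Circle.isAddQuotientCoveringMap_exp.fundamentalGroupEquiv ⟨x, hx⟩
  have hinj : Function.Injective (zmultiplesHom ℝ (2 * Real.pi)) := fun a b h => by
    have h' : a • (2 * Real.pi) = b • (2 * Real.pi) := h
    exact smul_left_injective ℤ Real.two_pi_pos.ne' h'
  let i : ℤ ≃+ AddSubgroup.zmultiples (2 * Real.pi) :=
    AddMonoidHom.ofInjective hinj
  exact ⟨e.trans (MulOpposite.opMulEquiv.symm.trans (AddEquiv.toMultiplicative i.symm))⟩

/-- For a regular covering with finite fibres, the image of the fundamental group of the total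
space is normal of finite index. -/
theorem IsCoveringMap.exists_normal_finiteIndex_mulEquiv {E X : Type*} [TopologicalSpace E]
    [TopologicalSpace X] {p : E → X} (cov : IsCoveringMap p)
    (htrans : ∀ e e' : E, p e = p e' → ∃ h : E ≃ₜ E, (∀ w, p (h w) = p w) ∧ h e = e')
    (e : E) (hfin : (p ⁻¹' {p e}).Finite) :
    ∃ H : Subgroup (FundamentalGroup X (p e)), H.Normal ∧ H.FiniteIndex ∧
      Nonempty (H ≃* FundamentalGroup E e) := by
  have : Finite (p ⁻¹' {p e}) := hfin
  have hinj : Function.Injective (FundamentalGroup.map ⟨p, cov.continuous⟩ e) :=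
    cov.injective_path_homotopic_map e e
  -- The image of `π₁(E)` is the stabilizer of `e` under monodromy. Deck transformations commute
  -- with monodromy and are transitive on the fibre, so a loop fixing `e` fixes every point; the
  -- stabilizer is thus the kernel of an action on a finite set.
  have hker : (cov.monodromyPerm (p e)).ker =
      (FundamentalGroup.map ⟨p, cov.continuous⟩ e).range := by
    ext γ
    constructor
    · intro hγ
      have h1 : cov.monodromy γ ⟨e, rfl⟩ = ⟨e, rfl⟩ := congrArg (fun σ => σ ⟨e, rfl⟩) hγ
      refine ⟨(cov.liftPathQuotient γ ⟨e, rfl⟩).cast rfl (congrArg Subtype.val h1).symm, ?_⟩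
      refine (Path.Homotopic.Quotient.map_cast _).trans ?_
      rw [cov.map_liftPathQuotient]
      obtain ⟨γ⟩ := γ
      rfl
    · rintro ⟨⟨a⟩, rfl⟩
      refine Equiv.ext fun e' => ?_
      obtain ⟨h, hp, he⟩ := htrans e e' e'.2.symm
      refine cov.monodromy_eq_of_map_eq (γ := .mk (a.map cov.continuous)) (ex := e') (ey := e')
        (.mk ((a.map h.continuous).cast he.symm he.symm)) ?_
      refine congrArg Path.Homotopic.Quotient.mk (Path.ext (funext fun t => ?_))
      exact hp (a t)
  refine ⟨(cov.monodromyPerm (p e)).ker, inferInstance, inferInstance, ?_⟩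
  rw [hker]
  exact ⟨(MonoidHom.ofInjective hinj).symm⟩

end FundamentalGroup

/-! ### Pullbacks of coverings -/

section Pullback

variable {Y X T : Type*} [TopologicalSpace Y] [TopologicalSpace X] [TopologicalSpace T]

/-- The pullback of a covering map is a covering map. -/
theorem IsCoveringMap.pullback_snd {p : Y → X} (cov : IsCoveringMap p) {f : T → X}
    (hf : Continuous f) : IsCoveringMap (fun z : Function.Pullback p f => z.1.2) := by
  intro t
  obtain ⟨disc, U, hxU, hU, hfU, H, hH⟩ := cov (f t)
  have hc : Continuous (fun z : Function.Pullback p f => z.1.2) := by fun_prop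
  refine IsEvenlyCovered.to_isEvenlyCovered_preimage (I := p ⁻¹' {f t})
    ⟨inferInstance, f ⁻¹' U, hxU, hU.preimage hf, (hU.preimage hf).preimage hc, ?_, ?_⟩
  · exact
      { toFun := fun z => (⟨z.1.1.2, z.2⟩, (H ⟨z.1.1.1, by
          rw [Set.mem_preimage, z.1.2]; exact z.2⟩).2)
        invFun := fun w => ⟨⟨((H.symm (⟨f w.1, w.1.2⟩, w.2)).1, w.1.1), by
          rw [← hH, H.apply_symm_apply]⟩, w.1.2⟩
        left_inv := fun z => by
          refine Subtype.ext (Subtype.ext (Prod.ext ?_ rfl))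
          have hz : p z.1.1.1 ∈ U := by rw [z.1.2]; exact z.2
          have : (⟨⟨f z.1.1.2, z.2⟩, (H ⟨z.1.1.1, hz⟩).2⟩ : U × p ⁻¹' {f t}) =
              H ⟨z.1.1.1, hz⟩ :=
            Prod.ext (Subtype.ext ((hH ⟨z.1.1.1, hz⟩).trans z.1.2).symm) rfl
          change (H.symm (⟨f z.1.1.2, z.2⟩, (H ⟨z.1.1.1, hz⟩).2)).1 = z.1.1.1
          rw [this, H.symm_apply_apply]
        right_inv := fun w => by
          refine Prod.ext rfl ?_
          change (H (H.symm (⟨f w.1, w.1.2⟩, w.2))).2 = w.2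
          rw [H.apply_symm_apply]
        continuous_toFun := by fun_prop
        continuous_invFun := by fun_prop }
  · intro z
    rfl

/-- Deck transformations act transitively on the fibres of a pullback of a regular covering. -/
theorem IsFiniteGaloisCover.exists_homeomorph_pullback {p : Y → X} (hp : IsFiniteGaloisCover p)
    {f : T → X} (z z' : Function.Pullback p f) (h : z.1.2 = z'.1.2) :
    ∃ g : Function.Pullback p f ≃ₜ Function.Pullback p f,
      (∀ w, (g w).1.2 = w.1.2) ∧ g z = z' := by
  obtain ⟨g, hg, hgz⟩ := hp.transitive z.1.1 z'.1.1 (by rw [z.2, z'.2, h])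
  refine ⟨(g.prodCongr (Homeomorph.refl T)).subtype fun w => ?_, fun w => rfl,
    Subtype.ext (Prod.ext hgz h)⟩
  change p w.1 = f w.2 ↔ p (g w.1) = f w.2
  rw [hg]

/-- The total space of the pullback bundle is the fibre product. -/
noncomputable def pullbackTotalSpaceHomeomorph {F : Type*} {E : X → Type*}
    [TopologicalSpace (TotalSpace F E)] (p : Y → X) :
    TotalSpace F (p *ᵖ E) ≃ₜ Function.Pullback p (π F E) :=
  let e : TotalSpace F (p *ᵖ E) ≃ Function.Pullback p (π F E) :=
    { toFun := fun v => ⟨pullbackTotalSpaceEmbedding p v, rfl⟩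
      invFun := fun w => ⟨w.1.1, cast (congrArg E w.2.symm) w.1.2.2⟩
      left_inv := fun v => rfl
      right_inv := by
        rintro ⟨⟨y, ⟨x, v⟩⟩, h⟩
        obtain rfl : p y = x := h
        rfl }
  e.toHomeomorphOfIsInducing <| by
    refine (IsInducing.of_comp_iff IsInducing.subtypeVal).1 ?_
    exact inducing_pullbackTotalSpaceEmbedding F E p

end Pullback

/-! ### The fundamental group of the total space -/

section CircleBundle

variable {X Y : Type*} [TopologicalSpace X] [TopologicalSpace Y] {E : X → Type*}
  [∀ x, TopologicalSpace (E x)] [∀ x, Nonempty (E x)] [TopologicalSpace (TotalSpace Circle E)]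
  [FiberBundle Circle E]

/-- If a circle bundle becomes trivial on a finite Galois covering `Y`, the fundamental group of its
total space is virtually the product of `ℤ` and the fundamental group of `Y`. -/
theorem IsFiniteGaloisCover.exists_subgroup_mulEquiv [LocallyPathConnectedSpace X]
    {p : C(Y, X)} (hp : IsFiniteGaloisCover p)
    (htriv : IsTrivialO2CircleBundle (p *ᵖ E)) (e₀ : TotalSpace Circle E) :
    ∃ H : Subgroup (FundamentalGroup (TotalSpace Circle E) e₀), H.Normal ∧ H.FiniteIndex ∧
      ∀ y₀ : Y, Nonempty (H ≃* Multiplicative ℤ × FundamentalGroup Y y₀) := by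
  obtain ⟨y, hy⟩ := hp.surjective e₀.1
  let z : Function.Pullback p (π Circle E) := ⟨(y, e₀), hy⟩
  have cov := hp.isCoveringMap.pullback_snd (f := π Circle E) (FiberBundle.continuous_proj Circle E)
  have hfin : ((fun z : Function.Pullback p (π Circle E) => z.1.2) ⁻¹' {e₀}).Finite := by
    refine Set.Finite.of_finite_image (f := fun z => z.1.1) ((hp.finite_fiber e₀.1).subset ?_) ?_
    · rintro _ ⟨w, rfl, rfl⟩
      exact w.2
    · rintro w hw w' hw' h
      exact Subtype.ext (Prod.ext h (hw.trans hw'.symm))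
  obtain ⟨H, hn, hi, ⟨e⟩⟩ := cov.exists_normal_finiteIndex_mulEquiv
    hp.exists_homeomorph_pullback z hfin
  refine ⟨H, hn, hi, fun y₀ => ?_⟩
  have := hp.connected
  have : LocallyPathConnectedSpace Y :=
    hp.isCoveringMap.isLocalHomeomorph.locallyPathConnectedSpace
  have : PathConnectedSpace Y := .of_locallyPathConnectedSpace
  obtain ⟨-, t, ht, -⟩ := htriv
  let Φ : TotalSpace Circle (p *ᵖ E) ≃ₜ Y × Circle :=
    t.toOpenPartialHomeomorph.toHomeomorphOfSourceEqUnivTargetEqUniv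
      (by rw [t.source_eq, ht, Set.preimage_univ]) (by rw [t.target_eq, ht, Set.univ_prod_univ])
  -- The fibre product covering the total space of `E` is also the total space of `p*E`, hence `Y ×
  -- S¹`.
  let Ψ := (pullbackTotalSpaceHomeomorph (F := Circle) (E := E) p).symm.trans Φ
  obtain ⟨e₁⟩ := Ψ.nonempty_fundamentalGroup_mulEquiv z
  obtain ⟨e₂⟩ := nonempty_fundamentalGroup_prod_mulEquiv (Ψ z).1 (Ψ z).2
  obtain ⟨e₃⟩ := Circle.nonempty_fundamentalGroup_mulEquiv (Ψ z).2
  let e₄ := FundamentalGroup.fundamentalGroupMulEquivOfPathConnected (Ψ z).1 y₀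
  exact ⟨((e.trans e₁).trans e₂).trans ((e₄.prodCongr e₃).trans MulEquiv.prodComm)⟩

end CircleBundle

-- The main theorem

universe u v

theorem proposition2p1 (n : ℕ) (X : Type u) [TopologicalSpace X] [T2Space X]
    [SecondCountableTopology X] [ChartedSpace (EuclideanSpace ℝ (Fin n)) X] [ConnectedSpace X]
    (x₀ : X) (hfg : Group.FG (FundamentalGroup X x₀))
    (E : X → Type v) [∀ x, TopologicalSpace (E x)] [∀ x, Nonempty (E x)]
    [TopologicalSpace (TotalSpace Circle E)] [FiberBundle Circle E]
    (hE : IsFlatO2CircleBundle E) :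
    ∃ (Y : Type u) (_ : TopologicalSpace Y) (p : C(Y, X)),
      IsFiniteGaloisCover p ∧
      IsTrivialO2CircleBundle (p *ᵖ E) ∧
      ∀ e₀ : TotalSpace Circle E, ∃ H : Subgroup (FundamentalGroup (TotalSpace Circle E) e₀),
        H.Normal ∧ H.FiniteIndex ∧
        ∀ y₀ : Y, Nonempty (H ≃* Multiplicative ℤ × FundamentalGroup Y y₀) := by
  have : LocallyPathConnectedSpace X :=
    ChartedSpace.locallyPathConnectedSpace (EuclideanSpace ℝ (Fin n)) X
  have : LocallyCompactSpace X := ChartedSpace.locallyCompactSpace (EuclideanSpace ℝ (Fin n)) X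
  -- The discrete topology encodes flatness: with it, the principal bundle is a covering.
  let _ : TopologicalSpace O2 := ⊥
  have : DiscreteTopology O2 := ⟨rfl⟩
  let Z := hE.cocycle
  let e : π O2 (Z.assoc O2).Fiber ⁻¹' {x₀} := ⟨Z.mkAt x₀ 1, rfl⟩
  obtain ⟨N, hN, hfin, l, hl⟩ :=
    exists_additive_angle (Z.monodromyGroup e) (Z.fg_monodromyGroup e hfg)
  have hcover := Z.isFiniteGaloisCover_quotientComponent e N hN hfin
  let p : C(Z.quotientComponent N (e : Z.AssocSpace O2), X) :=
    ⟨fun y => y.1.1, hcover.isCoveringMap.continuous⟩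
  have htriv : IsTrivialO2CircleBundle (p *ᵖ E) :=
    hE.isTrivialO2CircleBundle_pullback p N l hl Subtype.val continuous_subtype_val fun _ => rfl
  exact ⟨_, inferInstance, p, hcover, htriv, hcover.exists_subgroup_mulEquiv (p := p) htriv⟩
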